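/- Let $d\ge 1$, let $c_1,\dots,c_d\in\mathbb{C}$, and let $\psi_1,\dots,\psi_d:\mathbb{N}\to\mathbb{C}$ satisfy $\lim_{k\to\infty}\psi_j(k)=0$ for each $j$. Let $\{a_k\}_{k\ge 0}$ be a complex sequence, not identically zero, which solves the recurrence relation of Poincaré type $$a_k=\sum_{j=1}^d\,[c_j+\psi_j(k)]\,a_{k-j},\qquad k=d,d+1,\dots,$$ and let $R\in[0,\infty]$ be the radius of convergence of its generating function $f(z)=\sum_{k\ge 0}a_kz^k$. Then: 1. $R>0$. 2. If $a_k=0$ for all sufficiently large $k$, then $R=\infty$. Otherwise $R=|\sigma|^{-1}$ (with $0^{-1}=\infty$) for some characteristic root $\sigma$ (depending on the solution), i.e. some root $\sigma\in\mathbb{C}$ of $\Theta(\sigma)=\sigma^d-\sum_{j=1}^d c_j\sigma^{d-j}$. 3. For every finite $r$ with $0<r\le R$ (in particular for $r=R$ if $R<\infty$), $f$ satisfies $(d-1,r,S(k))$-Taylor domination with $$S(k)=|a_k|\,\tilde R^{k}\,\Bigl(\max_{0\le i\le d-1}|a_i|\,\tilde R^{i}\Bigr)^{-1},\qquad \tilde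 R=\begin{cases}R & \text{if } R<\infty,\\ r & \text{if } R=\infty.\end{cases}$$ Here, for $N\in\mathbb{N}$, a finite $r>0$ not exceeding the radius of convergence of $f$, and a nonnegative sequence $S(k)$, the function $f$ is said to satisfy $(N,r,S(k))$-Taylor domination if $S$ is of sub-exponential growth, that is, $\lim_{k\to\infty}S(k)e^{-\varepsilon k}=0$ for every $\varepsilon>0$, and $$|a_k|\,r^k\le S(k)\max_{0\le i\le N}|a_i|\,r^i\qquad\text{for all } k\ge N+1.$$ -/

import Mathlib

namespace PoincarePerron

/-- A linear recurrence relation of Poincaré type and order `d` (an element of the Poincaré class):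
complex numbers `c j` and perturbations `ψ j k`, relevant for `1 ≤ j ≤ d`, such that
`ψ j k → 0` as `k → ∞`. -/
structure PoincareRecurrence (d : ℕ) where
  c : ℕ → ℂ
  ψ : ℕ → ℕ → ℂ
  tendsto_ψ : ∀ j ∈ Finset.Icc 1 d, Filter.Tendsto (ψ j) Filter.atTop (nhds 0)

/-- `a` solves the recurrence: `a_k = ∑_{j=1}^d (c_j + ψ_j(k)) a_{k-j}` for all `k ≥ d`. -/
def PoincareRecurrence.IsSolution {d : ℕ} (S : PoincareRecurrence d) (a : ℕ → ℂ) : Prop :=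
  ∀ k, d ≤ k → a k = ∑ j ∈ Finset.Icc 1 d, (S.c j + S.ψ j k) * a (k - j)

/-- The characteristic polynomial `X^d - ∑_{j=1}^d c_j X^{d-j}`; its roots are the
characteristic roots of the recurrence. -/
noncomputable def PoincareRecurrence.charPoly {d : ℕ} (S : PoincareRecurrence d) :
    Polynomial ℂ :=
  Polynomial.X ^ d - ∑ j ∈ Finset.Icc 1 d, Polynomial.C (S.c j) * Polynomial.X ^ (d - j)

/-- The radius of convergence, in `[0, ∞]`, of the generating function `∑ a_k z^k`. -/
noncomputable def genRadius (a : ℕ → ℂ) : ENNReal :=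
  (FormalMultilinearSeries.ofScalars ℂ a).radius

/-- A nonnegative sequence of sub-exponential growth. -/
def IsSubexponential (S : ℕ → ℝ) : Prop :=
  (∀ k, 0 ≤ S k) ∧
    ∀ ε : ℝ, 0 < ε →
      Filter.Tendsto (fun k : ℕ => S k / Real.exp (ε * (k : ℝ))) Filter.atTop (nhds 0)

/-- `max_{i = 0, …, N} |a_i| r^i`. -/
noncomputable def initialMax (a : ℕ → ℂ) (N : ℕ) (r : ℝ) : ℝ :=
  (Finset.range (N + 1)).sup' Finset.nonempty_range_add_one (fun i => ‖a i‖ * r ^ i)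

/-- The `(N, r, S(k))`-Taylor domination property of the generating function `∑ a_k z^k`. -/
def TaylorDomination (a : ℕ → ℂ) (N : ℕ) (r : ℝ) (S : ℕ → ℝ) : Prop :=
  0 < r ∧ ENNReal.ofReal r ≤ genRadius a ∧ IsSubexponential S ∧
    ∀ k, N + 1 ≤ k → ‖a k‖ * r ^ k ≤ S k * initialMax a N r

open Classical in
/-- The radius used in the dominating sequence: the radius of convergence if that is finite,
and the given number `r` otherwise. -/
noncomputable def auxRadius (a : ℕ → ℂ) (r : ℝ) : ℝ :=
  if genRadius a = ⊤ then r else (genRadius a).toReal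

/-- The dominating sequence `S(k) = |a_k| ρ^k (max_{i ≤ N} |a_i| ρ^i)⁻¹`, `ρ = auxRadius a r`. -/
noncomputable def dominatingSeq (a : ℕ → ℂ) (N : ℕ) (r : ℝ) (k : ℕ) : ℝ :=
  ‖a k‖ * auxRadius a r ^ k * (initialMax a N (auxRadius a r))⁻¹

end PoincarePerron

/-!
The radius of convergence `R` of a solution of a Poincaré type recurrence is controlled through the
weighted norm `N_s(p) = ∑ |p_k| s^k` on polynomials.

Let `Q = 1 - ∑ c_j X^j = ∏ (1 - σ_i X)` be the reversed characteristic polynomial. Since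
multiplication by `σ X` scales `N_s` by exactly `|σ| s`, the triangle inequality gives
`N_s(Q p) ≥ ∏ |1 - |σ_i| s| · N_s(p)` (`le_weightedNorm_prod_mul`). Apply this to the truncation `p`
of the generating function at length `n`, with `L_n = N_s(p) = ∑_{k<n} |a_k| s^k`. By the
recurrence, `Q p` consists of a fixed number of initial coefficients, of the small terms
`∑_j ψ_j(k) a_{k-j}`, and of `d` terms at the end produced by the truncation
(`IsSolution.weightedNorm_mul_truncation_le`). If `0 < R < ∞` and no root has modulus `1 / R`, this
yields, for `s` near `R`,
`L_n ≤ A + B (L_n - L_{n-d})`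
with `B` independent of `s`. For `s > R` the sums `L_n` are unbounded, so the inequality makes them
grow like `q^(n/d)` with `q = 1 + 1 / (2B)` independent of `s` (`exists_pow_le_of_le_add_mul_sub`).
But `L_n = O(n (s / r)^n)` for every `r < R`, and `s / r` can be as close to `1` as desired: a
contradiction (`IsSolution.exists_mem_roots_norm_mul_eq_one`).

If `R = ∞` and `c_d ≠ 0`, the recurrence can be solved backwards, and for large `s` the tails of
`∑ |a_k| s^k` are at most half of themselves, hence vanish
(`IsSolution.eventually_eq_zero_of_genRadius_eq_top`). So a solution that is not eventually zero and
has `R = ∞` forces `c_d = 0`, and then `0` is a characteristic root.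

Positivity of `R` is the geometric growth bound for a recurrence with bounded coefficients, and
Taylor domination follows from the definition of `R` by comparing powers
(`IsSolution.taylorDomination`).
-/

namespace PoincarePerron

open Filter Topology Polynomial Finset

/-! ### Radius of convergence and size of coefficients -/

theorem le_genRadius_of_bound {a : ℕ → ℂ} {r C : ℝ} (hr : 0 ≤ r)
    (h : ∀ k, ‖a k‖ * r ^ k ≤ C) : ENNReal.ofReal r ≤ genRadius a := by
  lift r to NNReal using hr
  rw [ENNReal.ofReal_coe_nnreal]
  exact FormalMultilinearSeries.le_radius_of_bound _ C
    fun n => by simpa [FormalMultilinearSeries.ofScalars_norm] using h n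

theorem summable_of_lt_genRadius {a : ℕ → ℂ} {r : ℝ} (hr : 0 ≤ r)
    (h : ENNReal.ofReal r < genRadius a) : Summable fun k => ‖a k‖ * r ^ k := by
  lift r to NNReal using hr
  rw [ENNReal.ofReal_coe_nnreal] at h
  simpa [FormalMultilinearSeries.ofScalars_norm] using
    FormalMultilinearSeries.summable_norm_mul_pow _ h

theorem exists_bound_of_lt_genRadius {a : ℕ → ℂ} {r : ℝ} (hr : 0 ≤ r)
    (h : ENNReal.ofReal r < genRadius a) : ∃ C, 0 ≤ C ∧ ∀ k, ‖a k‖ * r ^ k ≤ C :=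
  ⟨_, tsum_nonneg fun _ => by positivity, fun k =>
    (summable_of_lt_genRadius hr h).le_tsum k fun _ _ => by positivity⟩

theorem genRadius_eq_top_of_eventually_eq_zero {a : ℕ → ℂ} (h : ∀ᶠ k in atTop, a k = 0) :
    genRadius a = ⊤ :=
  FormalMultilinearSeries.radius_eq_top_of_eventually_eq_zero _ <|
    h.mono fun k hk => by simp [FormalMultilinearSeries.ofScalars, hk]

/-! ### Positivity of the radius of convergence -/

namespace PoincareRecurrence

variable {d : ℕ} (S : PoincareRecurrence d)

theorem exists_coeff_bound : ∃ M : ℝ, 1 ≤ M ∧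
    ∀ k, ∑ j ∈ Icc 1 d, ‖S.c j + S.ψ j k‖ ≤ M := by
  have h : Tendsto (fun k => ∑ j ∈ Icc 1 d, ‖S.c j + S.ψ j k‖) atTop
      (𝓝 (∑ j ∈ Icc 1 d, ‖S.c j + 0‖)) :=
    tendsto_finsetSum _ fun j hj => ((S.tendsto_ψ j hj).const_add _).norm
  obtain ⟨M, hM⟩ := h.bddAbove_range
  exact ⟨max M 1, le_max_right _ _, fun k => (hM ⟨k, rfl⟩).trans (le_max_left _ _)⟩

variable {S}

theorem IsSolution.genRadius_pos {a : ℕ → ℂ} (hd : 1 ≤ d) (ha : S.IsSolution a) :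
    0 < genRadius a := by
  obtain ⟨M, hM1, hM⟩ := S.exists_coeff_bound
  have hM0 : 0 < M := by linarith
  set A := ∑ i ∈ range d, ‖a i‖
  have hA0 : 0 ≤ A := sum_nonneg fun _ _ => norm_nonneg _
  -- geometric growth, by induction on the recurrence
  have key : ∀ k, ‖a k‖ ≤ A * M ^ k := by
    intro k
    induction k using Nat.strong_induction_on with
    | _ k ih =>
      rcases lt_or_ge k d with hk | hk
      · calc ‖a k‖ ≤ A := single_le_sum (f := fun i => ‖a i‖) (fun _ _ => norm_nonneg _)
              (mem_range.2 hk)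
          _ ≤ A * M ^ k := le_mul_of_one_le_right hA0 (one_le_pow₀ hM1)
      have hk0 : 0 < k := by omega
      rw [ha k hk]
      calc ‖∑ j ∈ Icc 1 d, (S.c j + S.ψ j k) * a (k - j)‖
          ≤ ∑ j ∈ Icc 1 d, ‖S.c j + S.ψ j k‖ * (A * M ^ (k - 1)) := by
            refine norm_sum_le_of_le _ fun j hj => ?_
            rw [mem_Icc] at hj
            rw [norm_mul]
            gcongr
            refine (ih (k - j) (by omega)).trans ?_
            exact mul_le_mul_of_nonneg_left (pow_le_pow_right₀ hM1 (by omega)) hA0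
        _ = (∑ j ∈ Icc 1 d, ‖S.c j + S.ψ j k‖) * (A * M ^ (k - 1)) := (sum_mul _ _ _).symm
        _ ≤ M * (A * M ^ (k - 1)) := by gcongr; exact hM k
        _ = A * M ^ k := by
            rw [← mul_pow_sub_one hk0.ne' M]; ring
  refine lt_of_lt_of_le ?_ (le_genRadius_of_bound (a := a) (r := M⁻¹) (C := A) (by positivity) ?_)
  · rw [ENNReal.ofReal_pos]; positivity
  · intro k
    rw [inv_pow, ← div_eq_mul_inv, div_le_iff₀ (by positivity)]
    exact key k

/-! ### Superexponentially decaying solutions -/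

/-- If the last coefficient `c_d` does not vanish, the recurrence can be solved backwards. For
large `s` this makes the tails of `∑ |a_k| s^k` satisfy `U_{m} ≤ U_{m+1} / 2 ≤ U_{m} / 2`. -/
theorem IsSolution.eventually_eq_zero_of_genRadius_eq_top {a : ℕ → ℂ} (hd : 1 ≤ d)
    (ha : S.IsSolution a) (hR : genRadius a = ⊤) (hc : S.c d ≠ 0) :
    ∀ᶠ k in atTop, a k = 0 := by
  obtain ⟨M, hM1, hM⟩ := S.exists_coeff_bound
  set γ := ‖S.c d‖ with hγ
  have hγ0 : 0 < γ := norm_pos_iff.2 hc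
  have hlim : Tendsto (fun k => ‖S.c d + S.ψ d k‖) atTop (𝓝 γ) := by
    simpa using ((S.tendsto_ψ d (mem_Icc.2 ⟨hd, le_rfl⟩)).const_add (S.c d)).norm
  obtain ⟨K, hK⟩ := eventually_atTop.1 (hlim.eventually_const_lt (half_lt_self hγ0))
  set C := 2 / γ * (1 + M) with hC
  have hC0 : 0 < C := by positivity
  -- `s` is chosen so that the factor `C d / s` is at most `1/2`.
  set s := 2 * (C * d) + 1 with hs
  have hs1 : 1 ≤ s := by rw [hs]; linarith [show 0 ≤ C * d by positivity]
  have hs0 : 0 < s := by linarith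
  set b : ℕ → ℝ := fun k => ‖a k‖ * s ^ k with hb
  have hb0 : ∀ k, 0 ≤ b k := fun k => by positivity
  have hsum : Summable b := summable_of_lt_genRadius hs0.le
    (by rw [hR]; exact ENNReal.ofReal_lt_top)
  -- `a_m` is expressed through `a_{m+1}, …, a_{m+d}`
  have step : ∀ m, K ≤ m → b m ≤ C / s * ∑ i ∈ range d, b (m + 1 + i) := by
    intro m hm
    have h1 := ha (m + d) (by omega)
    have hIcc : Icc 1 d = insert d (Ico 1 d) := by
      ext x; simp only [mem_Icc, mem_insert, mem_Ico]; omega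
    rw [hIcc, sum_insert (by simp), Nat.add_sub_cancel] at h1
    have h2 : (S.c d + S.ψ d (m + d)) * a m =
        a (m + d) - ∑ j ∈ Ico 1 d, (S.c j + S.ψ j (m + d)) * a (m + d - j) := by
      rw [h1]; ring
    set W := ∑ i ∈ range d, ‖a (m + 1 + i)‖ with hW
    have hle : ∀ x, m + 1 ≤ x → x ≤ m + d → ‖a x‖ ≤ W := by
      intro x hx hx'
      have := single_le_sum (s := range d) (f := fun i => ‖a (m + 1 + i)‖)
        (fun _ _ => norm_nonneg _) (mem_range.2 (show x - (m + 1) < d by omega))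
      simpa only [show m + 1 + (x - (m + 1)) = x by omega] using this
    have hW0 : 0 ≤ W := sum_nonneg fun _ _ => norm_nonneg _
    have h3 : ‖∑ j ∈ Ico 1 d, (S.c j + S.ψ j (m + d)) * a (m + d - j)‖ ≤ M * W := by
      calc _ ≤ ∑ j ∈ Ico 1 d, ‖S.c j + S.ψ j (m + d)‖ * W := by
            refine norm_sum_le_of_le _ fun j hj => ?_
            rw [mem_Ico] at hj
            rw [norm_mul]
            gcongr
            exact hle _ (by omega) (by omega)
        _ = (∑ j ∈ Ico 1 d, ‖S.c j + S.ψ j (m + d)‖) * W := by rw [sum_mul]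
        _ ≤ M * W := by
            gcongr
            refine (sum_le_sum_of_subset_of_nonneg (Ico_subset_Icc_self) ?_).trans (hM (m + d))
            intros; positivity
    have h4 : γ / 2 * ‖a m‖ ≤ (1 + M) * W := by
      calc γ / 2 * ‖a m‖ ≤ ‖S.c d + S.ψ d (m + d)‖ * ‖a m‖ := by
            gcongr; exact (hK (m + d) (by omega)).le
        _ = ‖a (m + d) - ∑ j ∈ Ico 1 d, (S.c j + S.ψ j (m + d)) * a (m + d - j)‖ := by
            rw [← h2, norm_mul]
        _ ≤ W + M * W := (norm_sub_le _ _).trans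
            (add_le_add (hle _ (by omega) le_rfl) h3)
        _ = _ := by ring
    have h5 : ‖a m‖ ≤ C * W := by
      rw [hC, mul_assoc, div_mul_eq_mul_div, le_div_iff₀ hγ0]
      linarith
    -- the indices are at least `m + 1`, which gains the factor `1 / s`
    have h6 : W * s ^ (m + 1) ≤ ∑ i ∈ range d, b (m + 1 + i) := by
      rw [hW, sum_mul]
      refine sum_le_sum fun i _ => ?_
      simp only [hb]
      gcongr ?_ * ?_
      exact pow_le_pow_right₀ hs1 (by omega)
    calc b m = ‖a m‖ * s ^ m := rfl
      _ ≤ C * W * s ^ m := by gcongr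
      _ = C / s * (W * s ^ (m + 1)) := by rw [pow_succ]; field_simp
      _ ≤ _ := by gcongr
  have hshift : ∀ n, Summable fun i => b (i + n) := fun n => (summable_nat_add_iff n).2 hsum
  have hmono : ∀ n i, ∑' k, b (k + (n + i)) ≤ ∑' k, b (k + n) := by
    intro n i
    have := (hshift n).sum_add_tsum_nat_add i
    have h0 : 0 ≤ ∑ k ∈ range i, b (k + n) := sum_nonneg fun _ _ => hb0 _
    simp only [show ∀ k, k + i + n = k + (n + i) by intro k; omega] at this
    linarith
  set U := ∑' k, b (k + K) with hU
  have hU0 : 0 ≤ U := tsum_nonneg fun _ => hb0 _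
  have hU1 : U ≤ C / s * (d * U) := by
    have hsm : ∀ i ∈ range d, Summable fun k => b (k + K + 1 + i) := fun i _ => by
      simpa only [show ∀ k, k + K + 1 + i = k + (K + (1 + i)) by intro k; omega]
        using hshift (K + (1 + i))
    calc U ≤ ∑' k, C / s * ∑ i ∈ range d, b (k + K + 1 + i) :=
          (hshift K).tsum_le_tsum (fun k => step _ (by omega))
            ((summable_sum hsm).mul_left _)
      _ = C / s * ∑ i ∈ range d, ∑' k, b (k + K + 1 + i) := by
          rw [tsum_mul_left, Summable.tsum_finsetSum hsm]
      _ ≤ C / s * ∑ i ∈ range d, U := by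
          gcongr with i
          simpa only [show ∀ k, k + K + 1 + i = k + (K + (1 + i)) by intro k; omega]
            using hmono K (1 + i)
      _ = _ := by simp
  have hU2 : U = 0 := by
    have : C / s * (d * U) = (C * d) * U / s := by ring
    rw [this, le_div_iff₀ hs0] at hU1
    have : 0 ≤ C * d * U := by positivity
    nlinarith
  refine eventually_atTop.2 ⟨K, fun k hk => ?_⟩
  have h1 := (hshift K).le_tsum (k - K) fun _ _ => hb0 _
  rw [← hU, hU2, Nat.sub_add_cancel hk] at h1
  have h2 : b k = 0 := le_antisymm h1 (hb0 k)
  simpa [hb, hs0.ne'] using h2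

end PoincareRecurrence

/-! ### A weighted norm on polynomials -/

/-- The weighted norm `∑ |p_k| s^k` of a polynomial `p`. -/
noncomputable def weightedNorm (s : ℝ) (p : ℂ[X]) : ℝ :=
  p.sum fun k x => ‖x‖ * s ^ k

theorem weightedNorm_eq_sum (s : ℝ) {p : ℂ[X]} {n : ℕ} (h : p.natDegree < n) :
    weightedNorm s p = ∑ k ∈ range n, ‖p.coeff k‖ * s ^ k :=
  p.sum_over_range' (by simp) n h

theorem weightedNorm_nonneg {s : ℝ} (hs : 0 ≤ s) (p : ℂ[X]) : 0 ≤ weightedNorm s p :=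
  sum_nonneg fun _ _ => by positivity

theorem weightedNorm_add_le {s : ℝ} (hs : 0 ≤ s) (p q : ℂ[X]) :
    weightedNorm s (p + q) ≤ weightedNorm s p + weightedNorm s q := by
  set n := max p.natDegree q.natDegree + 1
  rw [weightedNorm_eq_sum s (n := n) (Nat.lt_succ_of_le (natDegree_add_le p q)),
    weightedNorm_eq_sum s (n := n) (Nat.lt_succ_of_le (le_max_left _ _)),
    weightedNorm_eq_sum s (n := n) (Nat.lt_succ_of_le (le_max_right _ _)), ← sum_add_distrib]
  refine sum_le_sum fun k _ => ?_
  rw [coeff_add, ← add_mul]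
  gcongr
  exact norm_add_le _ _

theorem weightedNorm_neg (s : ℝ) (p : ℂ[X]) : weightedNorm s (-p) = weightedNorm s p := by
  simp [weightedNorm, Polynomial.sum_def]

theorem weightedNorm_C_mul_X_mul (s : ℝ) (σ : ℂ) (p : ℂ[X]) :
    weightedNorm s (C σ * X * p) = ‖σ‖ * s * weightedNorm s p := by
  have h : (C σ * X * p).natDegree < p.natDegree + 2 := by
    have h1 := natDegree_mul_le (p := C σ * X) (q := p)
    have h2 := natDegree_C_mul_le σ (X : ℂ[X])
    rw [natDegree_X] at h2
    omega
  rw [weightedNorm_eq_sum s h, weightedNorm_eq_sum s p.natDegree.lt_succ_self, sum_range_succ']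
  simp only [mul_assoc, coeff_C_mul, coeff_X_mul, mul_coeff_zero, coeff_X_zero, norm_mul, mul_sum]
  simp only [zero_mul, mul_zero, norm_zero, add_zero]
  exact sum_congr rfl fun k _ => by ring

/-- Multiplication by `σX` scales the norm by exactly `|σ| s`, so the triangle inequality bounds
multiplication by `1 - σX` from below. -/
theorem le_weightedNorm_one_sub_mul {s : ℝ} (hs : 0 ≤ s) (σ : ℂ) (p : ℂ[X]) :
    |1 - ‖σ‖ * s| * weightedNorm s p ≤ weightedNorm s ((1 - C σ * X) * p) := by
  have h1 := weightedNorm_add_le hs ((1 - C σ * X) * p) (C σ * X * p)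
  have h2 := weightedNorm_add_le hs (-((1 - C σ * X) * p)) p
  rw [show (1 - C σ * X) * p + C σ * X * p = p by ring, weightedNorm_C_mul_X_mul] at h1
  rw [show -((1 - C σ * X) * p) + p = C σ * X * p by ring, weightedNorm_C_mul_X_mul,
    weightedNorm_neg] at h2
  have h3 := weightedNorm_nonneg hs p
  rw [show |1 - ‖σ‖ * s| * weightedNorm s p = |(1 - ‖σ‖ * s) * weightedNorm s p| by
    rw [abs_mul, abs_of_nonneg h3], abs_le]
  constructor <;> nlinarith

theorem le_weightedNorm_prod_mul {s : ℝ} (hs : 0 ≤ s) (m : Multiset ℂ) (p : ℂ[X]) :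
    (m.map fun σ => |1 - ‖σ‖ * s|).prod * weightedNorm s p ≤
      weightedNorm s ((m.map fun σ => 1 - C σ * X).prod * p) := by
  induction m using Multiset.induction_on with
  | empty => simp
  | cons σ m ih =>
    simp only [Multiset.map_cons, Multiset.prod_cons, mul_assoc]
    refine le_trans ?_ (le_weightedNorm_one_sub_mul hs σ _)
    gcongr

namespace PoincareRecurrence

variable {d : ℕ} (S : PoincareRecurrence d)

/-! ### The reversed characteristic polynomial -/

/-- The polynomial `1 - ∑_{j=1}^d c_j X^j`, i.e. the characteristic polynomial with its
coefficients reversed. -/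
noncomputable def reversedCharPoly : ℂ[X] :=
  1 - ∑ j ∈ Icc 1 d, C (S.c j) * X ^ j

theorem degree_sum_lt :
    (∑ j ∈ Icc 1 d, C (S.c j) * X ^ (d - j) : ℂ[X]).degree < d := by
  refine (degree_sum_le _ _).trans_lt ((Finset.sup_lt_iff (WithBot.bot_lt_coe d)).2 fun j hj => ?_)
  rw [mem_Icc] at hj
  refine (degree_C_mul_X_pow_le _ _).trans_lt ?_
  exact WithBot.coe_lt_coe.2 (by omega : d - j < d)

theorem charPoly_monic : S.charPoly.Monic :=
  monic_X_pow_sub S.degree_sum_lt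

theorem charPoly_natDegree : S.charPoly.natDegree = d := by
  refine natDegree_eq_of_degree_eq_some ?_
  rw [charPoly, degree_sub_eq_left_of_degree_lt] <;> rw [degree_X_pow]
  exact S.degree_sum_lt

theorem reverse_charPoly : S.charPoly.reverse = S.reversedCharPoly := by
  have hsum : ∀ (t : Finset ℕ) (f : ℕ → ℂ[X]),
      reflect d (∑ j ∈ t, f j) = ∑ j ∈ t, reflect d (f j) := by
    intro t f
    induction t using Finset.cons_induction with
    | empty => simp
    | cons i t hi ih => rw [sum_cons, sum_cons, reflect_add, ih]
  rw [reverse, S.charPoly_natDegree, charPoly, reversedCharPoly, reflect_sub, hsum,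
    reflect_monomial, revAt_le le_rfl, Nat.sub_self, pow_zero]
  congr 1
  refine sum_congr rfl fun j hj => ?_
  rw [mem_Icc] at hj
  rw [reflect_C_mul_X_pow, revAt_le (Nat.sub_le _ _), Nat.sub_sub_self hj.2]

theorem reversedCharPoly_eq_prod :
    S.reversedCharPoly = (S.charPoly.roots.map fun σ => 1 - C σ * X).prod := by
  have hrev : ∀ m : Multiset ℂ, (m.map fun σ => X - C σ).prod.reverse =
      (m.map fun σ => 1 - C σ * X).prod := by
    intro m
    induction m using Multiset.induction_on with
    | empty => simp [← C_1 (R := ℂ), -map_one]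
    | cons σ m ih =>
      simp only [Multiset.map_cons, Multiset.prod_cons]
      rw [reverse_mul_of_domain, ih, sub_eq_add_neg, ← C_neg, reverse_add_C, natDegree_X]
      have : (X : ℂ[X]).reverse = 1 := by simp [reverse]
      rw [this]
      simp [sub_eq_add_neg]
  rw [← S.reverse_charPoly, ← hrev,
    ← (IsAlgClosed.splits S.charPoly).eq_prod_roots_of_monic S.charPoly_monic]

/-- If no characteristic root has modulus `R⁻¹`, multiplication by the reversed characteristic
polynomial is bounded from below, with the same constant for all radii near `R`. -/
theorem exists_weightedNorm_lower_bound {R : ℝ}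
    (hroot : ∀ σ ∈ S.charPoly.roots, ‖σ‖ * R ≠ 1) :
    ∃ μ : ℝ, 0 < μ ∧ ∀ᶠ s in 𝓝 R, 0 ≤ s → ∀ p : ℂ[X],
      μ * weightedNorm s p ≤ weightedNorm s (S.reversedCharPoly * p) := by
  set φ : ℝ → ℝ := fun s => (S.charPoly.roots.map fun σ => |1 - ‖σ‖ * s|).prod with hφ
  have hcont : Continuous φ := continuous_multiset_prod _ fun σ _ => by fun_prop
  have hpos : 0 < φ R := by
    refine Multiset.prod_induction (fun x : ℝ => 0 < x) _ (fun _ _ => mul_pos) one_pos ?_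
    intro x hx
    obtain ⟨σ, hσ, rfl⟩ := Multiset.mem_map.1 hx
    exact abs_pos.2 (sub_ne_zero.2 (hroot σ hσ).symm)
  refine ⟨φ R / 2, half_pos hpos, ?_⟩
  filter_upwards [hcont.continuousAt.eventually_const_lt (half_lt_self hpos)] with s hs hs0 p
  rw [S.reversedCharPoly_eq_prod]
  refine le_trans ?_ (le_weightedNorm_prod_mul hs0 _ p)
  exact mul_le_mul_of_nonneg_right hs.le (weightedNorm_nonneg hs0 p)

end PoincareRecurrence
/-! ### Truncations of a solution -/

/-- The truncation `∑_{k < n} a_k X^k` of the generating function. -/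
noncomputable def truncation (a : ℕ → ℂ) (n : ℕ) : ℂ[X] :=
  ∑ k ∈ range n, C (a k) * X ^ k

theorem coeff_truncation (a : ℕ → ℂ) (n k : ℕ) :
    (truncation a n).coeff k = if k < n then a k else 0 := by
  simp [truncation, finsetSum_coeff, coeff_C_mul, coeff_X_pow]

/-- The partial sum `∑_{k < n} |a_k| s^k`. -/
noncomputable def absSum (a : ℕ → ℂ) (s : ℝ) (n : ℕ) : ℝ :=
  ∑ k ∈ range n, ‖a k‖ * s ^ k

theorem absSum_mono {a : ℕ → ℂ} {s : ℝ} (hs : 0 ≤ s) : Monotone (absSum a s) := fun _ _ h =>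
  sum_le_sum_of_subset_of_nonneg (range_mono h) fun _ _ _ => by positivity

theorem absSum_sub {a : ℕ → ℂ} {s : ℝ} {m n : ℕ} (h : m ≤ n) :
    absSum a s n - absSum a s m = ∑ k ∈ Ico m n, ‖a k‖ * s ^ k :=
  (sum_Ico_eq_sub _ h).symm

theorem natDegree_truncation_lt {a : ℕ → ℂ} {n : ℕ} (hn : 0 < n) :
    (truncation a n).natDegree < n := by
  refine (Nat.le_sub_one_iff_lt hn).1 (natDegree_le_iff_coeff_eq_zero.2 fun k hk => ?_)
  rw [coeff_truncation, if_neg (by omega)]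

theorem weightedNorm_truncation (a : ℕ → ℂ) (s : ℝ) {n : ℕ} (hn : 0 < n) :
    weightedNorm s (truncation a n) = absSum a s n := by
  rw [weightedNorm_eq_sum s (natDegree_truncation_lt hn), absSum]
  refine sum_congr rfl fun k hk => ?_
  rw [coeff_truncation, if_pos (mem_range.1 hk)]

theorem sum_comp_sub_le {b : ℕ → ℝ} (hb : ∀ k, 0 ≤ b k) {I J : Finset ℕ} {j : ℕ}
    (hI : ∀ k ∈ I, j ≤ k ∧ k - j ∈ J) : ∑ k ∈ I, b (k - j) ≤ ∑ k ∈ J, b k := by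
  have hinj : Set.InjOn (fun k => k - j) (I : Set ℕ) := fun x hx y hy h => by
    have h1 := (hI x hx).1
    have h2 := (hI y hy).1
    simp only at h
    omega
  rw [← sum_image (f := b) hinj]
  exact sum_le_sum_of_subset_of_nonneg (image_subset_iff.2 fun k hk => (hI k hk).2)
    fun _ _ _ => hb _

namespace PoincareRecurrence

variable {d : ℕ} {S : PoincareRecurrence d}

theorem coeff_reversedCharPoly_mul (p : ℂ[X]) (k : ℕ) :
    (S.reversedCharPoly * p).coeff k =
      p.coeff k - ∑ j ∈ Icc 1 d, S.c j * if j ≤ k then p.coeff (k - j) else 0 := by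
  simp only [reversedCharPoly, sub_mul, one_mul, sum_mul, coeff_sub, finsetSum_coeff, mul_assoc,
    coeff_C_mul, coeff_X_pow_mul']

/-- In the product of the reversed characteristic polynomial with a truncation of length `n` at
most `d` coefficients, those of index `n ≤ k < n + d`, come from cutting off the sequence; all
others from `K` on are `∑_j ψ_j(k) a_{k-j}`. -/
theorem IsSolution.weightedNorm_mul_truncation_le {a : ℕ → ℂ} (hd : 1 ≤ d) (ha : S.IsSolution a)
    {s δ : ℝ} (hs : 0 ≤ s) {K : ℕ} (hK : d ≤ K)
    (hδ : ∀ k, K ≤ k → ∀ j ∈ Icc 1 d, ‖S.ψ j k‖ * s ^ j ≤ δ) :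
    ∃ A : ℝ, ∀ n, K ≤ n → weightedNorm s (S.reversedCharPoly * truncation a n) ≤
      A + d * δ * absSum a s n +
        (∑ j ∈ Icc 1 d, ‖S.c j‖ * s ^ j) * (absSum a s n - absSum a s (n - d)) := by
  set b : ℕ → ℝ := fun k => ‖a k‖ * s ^ k with hb
  have hb0 : ∀ k, 0 ≤ b k := fun k => by positivity
  have hpow : ∀ (x : ℂ) {j k : ℕ}, j ≤ k → ‖x * a (k - j)‖ * s ^ k = ‖x‖ * s ^ j * b (k - j) := by
    intro x j k h
    rw [norm_mul, hb, ← Nat.add_sub_cancel' h, pow_add]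
    simp only [Nat.add_sub_cancel_left]
    ring
  -- the coefficients below `K` do not depend on the length `n ≥ K` of the truncation
  refine ⟨∑ k ∈ range K, ‖(S.reversedCharPoly * truncation a K).coeff k‖ * s ^ k,
    fun n hn => ?_⟩
  have hn0 : 0 < n := by omega
  have hdeg : (S.reversedCharPoly * truncation a n).natDegree < n + d := by
    have h1 : S.reversedCharPoly.natDegree ≤ d := by
      rw [← S.reverse_charPoly]
      exact (reverse_natDegree_le _).trans S.charPoly_natDegree.le
    have h2 := natDegree_mul_le (p := S.reversedCharPoly) (q := truncation a n)
    have h3 := natDegree_truncation_lt (a := a) hn0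
    omega
  rw [weightedNorm_eq_sum s hdeg,
    ← sum_range_add_sum_Ico _ (show n ≤ n + d by omega),
    ← sum_range_add_sum_Ico _ hn]
  refine add_le_add (add_le_add (le_of_eq ?_) ?_) ?_
  · refine sum_congr rfl fun k hk => ?_
    rw [mem_range] at hk
    simp only [coeff_reversedCharPoly_mul, coeff_truncation]
    rw [if_pos hk, if_pos (by omega : k < n)]
    congr 4
    funext j
    rw [if_pos (by omega : k - j < n), if_pos (by omega : k - j < K)]
  · calc ∑ k ∈ Ico K n, ‖(S.reversedCharPoly * truncation a n).coeff k‖ * s ^ k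
        ≤ ∑ k ∈ Ico K n, ∑ j ∈ Icc 1 d, δ * b (k - j) := by
          refine sum_le_sum fun k hk => ?_
          rw [mem_Ico] at hk
          have hcoef : (S.reversedCharPoly * truncation a n).coeff k =
              ∑ j ∈ Icc 1 d, S.ψ j k * a (k - j) := by
            rw [coeff_reversedCharPoly_mul, coeff_truncation, if_pos hk.2, ha k (by omega),
              ← sum_sub_distrib]
            refine sum_congr rfl fun j hj => ?_
            rw [mem_Icc] at hj
            rw [if_pos (by omega), coeff_truncation, if_pos (by omega)]
            ring
          rw [hcoef]
          calc _ ≤ (∑ j ∈ Icc 1 d, ‖S.ψ j k * a (k - j)‖) * s ^ k := by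
                gcongr; exact norm_sum_le _ _
            _ ≤ _ := by
                rw [sum_mul]
                refine sum_le_sum fun j hj => ?_
                rw [hpow _ (by rw [mem_Icc] at hj; omega)]
                exact mul_le_mul_of_nonneg_right (hδ k hk.1 j hj) (hb0 _)
      _ = ∑ j ∈ Icc 1 d, δ * ∑ k ∈ Ico K n, b (k - j) := by
          rw [sum_comm]; simp only [mul_sum]
      _ ≤ ∑ j ∈ Icc 1 d, δ * absSum a s n := by
          refine sum_le_sum fun j hj => ?_
          have hδ0 : 0 ≤ δ := le_trans (by positivity) (hδ K le_rfl j hj)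
          rw [mem_Icc] at hj
          refine mul_le_mul_of_nonneg_left (sum_comp_sub_le hb0 fun k hk => ?_) hδ0
          rw [mem_Ico] at hk
          exact ⟨by omega, mem_range.2 (by omega)⟩
      _ = _ := by simp [mul_assoc]
  · calc ∑ k ∈ Ico n (n + d), ‖(S.reversedCharPoly * truncation a n).coeff k‖ * s ^ k
        ≤ ∑ k ∈ Ico n (n + d), ∑ j ∈ Icc 1 d,
            ‖S.c j‖ * s ^ j * if k - j < n then b (k - j) else 0 := by
          refine sum_le_sum fun k hk => ?_
          rw [mem_Ico] at hk
          rw [coeff_reversedCharPoly_mul, coeff_truncation, if_neg (by omega), zero_sub, norm_neg]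
          calc _ ≤ (∑ j ∈ Icc 1 d,
                ‖S.c j * if j ≤ k then (truncation a n).coeff (k - j) else 0‖) * s ^ k := by
                gcongr; exact norm_sum_le _ _
            _ ≤ _ := by
                rw [sum_mul]
                refine sum_le_sum fun j hj => ?_
                rw [mem_Icc] at hj
                rw [if_pos (by omega), coeff_truncation]
                split_ifs
                · rw [hpow _ (by omega)]
                · simp
      _ = ∑ j ∈ Icc 1 d, ‖S.c j‖ * s ^ j *
            ∑ k ∈ Ico n (n + d) with k - j < n, b (k - j) := by
          rw [sum_comm]; simp only [mul_sum, sum_filter, mul_ite, mul_zero]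
      _ ≤ ∑ j ∈ Icc 1 d, ‖S.c j‖ * s ^ j * (absSum a s n - absSum a s (n - d)) := by
          refine sum_le_sum fun j hj => ?_
          rw [mem_Icc] at hj
          rw [absSum_sub (Nat.sub_le n d)]
          refine mul_le_mul_of_nonneg_left (sum_comp_sub_le hb0 fun k hk => ?_) (by positivity)
          rw [mem_filter, mem_Ico] at hk
          exact ⟨by omega, mem_Ico.2 ⟨by omega, hk.2⟩⟩
      _ = _ := by rw [sum_mul]

end PoincareRecurrence

/-! ### Exponential growth of the partial sums -/

/-- A bound of the partial sum by its last `d` terms forces exponential growth, at a rate that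
depends only on the factor `B` and not on the additive constant `A`. -/
theorem exists_pow_le_of_le_add_mul_sub {L : ℕ → ℝ} {A B : ℝ} {d K : ℕ} (hL : Monotone L)
    (hB : 0 < B) (hunb : ∀ x, ∃ n, x < L n)
    (h : ∀ n, K ≤ n → L n ≤ A + B * (L n - L (n - d))) :
    ∃ (N : ℕ) (x : ℝ), 0 < x ∧ ∀ i, x * (1 + 1 / (2 * B)) ^ i ≤ L (N + i * d) := by
  obtain ⟨n₀, hn₀⟩ := hunb (max 0 (2 * A))
  have h0 : ∀ i, max 0 (2 * A) < L (max n₀ K + i * d) := fun i =>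
    hn₀.trans_le (hL (by have := le_max_left n₀ K; omega))
  refine ⟨max n₀ K, L (max n₀ K), ?_, fun i => ?_⟩
  · simpa using (le_max_left _ _).trans_lt (h0 0)
  induction i with
  | zero => simp
  | succ i ih =>
    have h1 := h (max n₀ K + (i + 1) * d) (by have := le_max_right n₀ K; omega)
    rw [show max n₀ K + (i + 1) * d - d = max n₀ K + i * d by rw [add_mul]; omega] at h1
    have h2 := (le_max_right _ _).trans_lt (h0 i)
    have h3 : L (max n₀ K + i * d) ≤ L (max n₀ K + (i + 1) * d) := hL (by rw [add_mul]; omega)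
    have h4 : L (max n₀ K + i * d) * (1 + 1 / (2 * B)) ≤ L (max n₀ K + (i + 1) * d) := by
      rw [mul_add, mul_one, mul_one_div, ← le_sub_iff_add_le', div_le_iff₀ (by positivity)]
      linarith
    rw [pow_succ, ← mul_assoc]
    exact (mul_le_mul_of_nonneg_right ih (by positivity)).trans h4

theorem absSum_le {a : ℕ → ℂ} {r s C : ℝ} (hr : 0 < r) (hrs : r ≤ s)
    (h : ∀ k, ‖a k‖ * r ^ k ≤ C) (n : ℕ) : absSum a s n ≤ C * n * (s / r) ^ n := by
  have hC : 0 ≤ C := le_trans (by positivity) (h 0)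
  have h1 : 1 ≤ s / r := (one_le_div₀ hr).2 hrs
  calc absSum a s n ≤ ∑ k ∈ range n, C * (s / r) ^ n := by
        refine sum_le_sum fun k hk => ?_
        calc ‖a k‖ * s ^ k = ‖a k‖ * r ^ k * (s / r) ^ k := by
              rw [div_pow]; field_simp
          _ ≤ C * (s / r) ^ n := by
              exact mul_le_mul (h k) (pow_le_pow_right₀ h1 (mem_range.1 hk).le) (by positivity) hC
    _ = _ := by simp; ring

/-- A sequence bounded by `C n x^n` cannot grow like `q^i` along `n = N + i d` if `x^d < q`. -/
theorem not_forall_pow_le {L : ℕ → ℝ} {C x y q : ℝ} {d N : ℕ} (hy : 0 < y) (hx : 0 ≤ x)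
    (hq : 0 < q) (hxq : x ^ d < q) (hL : ∀ n : ℕ, L n ≤ C * n * x ^ n) :
    ¬ ∀ i, y * q ^ i ≤ L (N + i * d) := by
  intro h
  set z := x ^ d / q with hz
  have hz0 : 0 ≤ z := by positivity
  have hz1 : z < 1 := (div_lt_one hq).2 hxq
  have hlim : Tendsto (fun i : ℕ => C * x ^ N * (N * z ^ i + d * (i * z ^ i))) atTop (𝓝 0) := by
    have h1 := (tendsto_pow_atTop_nhds_zero_of_lt_one hz0 hz1).const_mul (N : ℝ)
    have h2 := (tendsto_self_mul_const_pow_of_lt_one hz0 hz1).const_mul (d : ℝ)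
    simpa using (h1.add h2).const_mul (C * x ^ N)
  refine absurd (ge_of_tendsto hlim (Eventually.of_forall fun i => ?_)) (not_le.2 hy)
  have h1 := (h i).trans (hL _)
  rw [← le_div_iff₀ (by positivity)] at h1
  refine h1.trans (le_of_eq ?_)
  rw [hz, div_pow, pow_add, mul_comm i d, pow_mul]
  push_cast
  field_simp

namespace PoincareRecurrence

variable {d : ℕ} {S : PoincareRecurrence d}

/-- If no characteristic root has modulus `R⁻¹`, then for `s` slightly larger than `R` the partial
sums `∑_{k<n} |a_k| s^k` grow like `q^n` with `q > 1` independent of `s`. On the other hand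
`|a_k| r^k` is bounded for `r < R`, and `s / r` may be taken as close to `1` as desired. -/
theorem IsSolution.exists_mem_roots_norm_mul_eq_one {a : ℕ → ℂ} (hd : 1 ≤ d) (ha : S.IsSolution a)
    {R : ℝ} (hR0 : 0 < R) (hR : genRadius a = ENNReal.ofReal R) :
    ∃ σ ∈ S.charPoly.roots, ‖σ‖ * R = 1 := by
  by_contra! hroot
  obtain ⟨μ, hμ, hμs⟩ := S.exists_weightedNorm_lower_bound hroot
  -- `2 * R` bounds all radii `s` considered, which makes `B` independent of `s`
  set B₀ := ∑ j ∈ Icc 1 d, ‖S.c j‖ * (2 * R) ^ j with hB₀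
  set B := 2 / μ * (B₀ + 1) with hB
  have hB₀0 : 0 ≤ B₀ := sum_nonneg fun _ _ => by positivity
  have hB0 : 0 < B := by positivity
  have hd0 : (0 : ℝ) < d := by exact_mod_cast hd
  -- `s / r = (s / R) ^ 2` for `r = R ^ 2 / s`
  have hratio : ∀ᶠ s in 𝓝 R, ((s / R) ^ 2) ^ d < 1 + 1 / (2 * B) := by
    have hc : ContinuousAt (fun s => ((s / R) ^ 2) ^ d) R := by fun_prop
    refine hc.eventually_lt_const ?_
    have h1 : 0 < 1 / (2 * B) := by positivity
    simpa [div_self hR0.ne'] using h1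
  obtain ⟨s, ⟨⟨hs1, hs2⟩, hs3⟩, hRs⟩ := ((((hμs.and hratio).and
    (eventually_lt_nhds (show R < 2 * R by linarith))).filter_mono nhdsWithin_le_nhds).and
    (self_mem_nhdsWithin : Set.Ioi R ∈ 𝓝[>] R)).exists
  have hs0 : 0 < s := hR0.trans hRs
  -- with this `δ` the perturbation terms take up at most half of `μ * absSum a s n`
  set δ := μ / (2 * d) with hδ
  have hδ0 : 0 < δ := by positivity
  have hev : ∀ᶠ k in atTop, ∀ j ∈ Icc 1 d, ‖S.ψ j k‖ * s ^ j ≤ δ := by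
    rw [eventually_all_finset]
    intro j hj
    have : Tendsto (fun k => ‖S.ψ j k‖ * s ^ j) atTop (𝓝 0) := by
      simpa using (S.tendsto_ψ j hj).norm.mul_const (s ^ j)
    exact (this.eventually_lt_const hδ0).mono fun _ h => h.le
  obtain ⟨K, hK⟩ := eventually_atTop.1 hev
  obtain ⟨A, hA⟩ := ha.weightedNorm_mul_truncation_le hd hs0.le (le_max_right K d)
    fun k hk => hK k ((le_max_left _ _).trans hk)
  have hineq : ∀ n, max K d ≤ n →
      absSum a s n ≤ 2 / μ * A + B * (absSum a s n - absSum a s (n - d)) := by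
    intro n hn
    have hn0 : 0 < n := by have := le_max_right K d; omega
    have h1 := (hs1 hs0.le (truncation a n)).trans (hA n hn)
    rw [weightedNorm_truncation a s hn0, show d * δ = μ / 2 by rw [hδ]; field_simp] at h1
    have h2 : 0 ≤ absSum a s n - absSum a s (n - d) :=
      sub_nonneg.2 (absSum_mono hs0.le (Nat.sub_le n d))
    have h3 : ∑ j ∈ Icc 1 d, ‖S.c j‖ * s ^ j ≤ B₀ + 1 := by
      refine le_trans (sum_le_sum fun j _ => ?_) (by linarith : B₀ ≤ B₀ + 1)
      gcongr
    have h4 := mul_le_mul_of_nonneg_right h3 h2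
    rw [hB, mul_assoc, ← mul_add, div_mul_eq_mul_div, le_div_iff₀ hμ]
    linarith
  -- bounded partial sums would give `s ≤ R`
  have hunb : ∀ x, ∃ n, x < absSum a s n := by
    by_contra! hbdd
    obtain ⟨x, hx⟩ := hbdd
    have := le_genRadius_of_bound (a := a) (C := x) hs0.le fun k =>
      (single_le_sum (f := fun k => ‖a k‖ * s ^ k) (fun _ _ => by positivity)
        (self_mem_range_succ k)).trans (hx (k + 1))
    rw [hR, ENNReal.ofReal_le_ofReal_iff hR0.le] at this
    linarith
  obtain ⟨N, y, hy, hN⟩ := exists_pow_le_of_le_add_mul_sub (absSum_mono hs0.le) hB0 hunb hineq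
  have hrR : R ^ 2 / s < R := by rw [div_lt_iff₀ hs0]; nlinarith
  have hr0 : 0 < R ^ 2 / s := by positivity
  obtain ⟨C, -, hC⟩ := exists_bound_of_lt_genRadius (a := a) hr0.le
    (by rw [hR]; exact (ENNReal.ofReal_lt_ofReal_iff hR0).2 hrR)
  refine not_forall_pow_le hy (x := s / (R ^ 2 / s)) (by positivity) (by positivity) ?_
    (absSum_le hr0 (hrR.trans hRs).le hC) hN
  convert hs2 using 2
  field_simp

end PoincareRecurrence

/-! ### Taylor domination -/

theorem le_initialMax (a : ℕ → ℂ) {N i : ℕ} (r : ℝ) (hi : i ≤ N) :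
    ‖a i‖ * r ^ i ≤ initialMax a N r :=
  le_sup' (fun i => ‖a i‖ * r ^ i) (mem_range.2 (by omega))

/-- A solution is determined by its first `d` terms, so these do not all vanish. -/
theorem PoincareRecurrence.IsSolution.initialMax_pos {d : ℕ} {S : PoincareRecurrence d}
    {a : ℕ → ℂ} (ha : S.IsSolution a) (ha0 : a ≠ 0) {r : ℝ} (hr : 0 < r) :
    0 < initialMax a (d - 1) r := by
  by_contra! h
  refine ha0 (funext fun k => ?_)
  induction k using Nat.strong_induction_on with
  | _ k ih =>
    rcases lt_or_ge k d with hk | hk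
    · have h1 := (le_initialMax a (N := d - 1) r (by omega : k ≤ d - 1)).trans h
      have h2 : ‖a k‖ ≤ 0 := by
        by_contra! h3
        exact absurd h1 (not_le.2 (by positivity))
      simpa using h2
    · rw [ha k hk]
      refine sum_eq_zero fun j hj => ?_
      rw [mem_Icc] at hj
      rcases Nat.eq_zero_or_pos k with h0 | h0
      · omega
      rw [ih (k - j) (by omega)]
      simp

theorem auxRadius_spec {a : ℕ → ℂ} {r : ℝ} (h : ENNReal.ofReal r ≤ genRadius a) :
    r ≤ auxRadius a r ∧ ENNReal.ofReal (auxRadius a r) ≤ genRadius a := by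
  unfold auxRadius
  split_ifs with htop
  · exact ⟨le_rfl, h⟩
  · exact ⟨(ENNReal.ofReal_le_iff_le_toReal htop).1 h, (ENNReal.ofReal_toReal htop).le⟩

/-- The coefficients of a power series are of sub-exponential growth after rescaling by a number
not exceeding the radius of convergence. -/
theorem isSubexponential_of_le_genRadius {a : ℕ → ℂ} {ρ m : ℝ} (hρ : 0 < ρ) (hm : 0 ≤ m)
    (h : ENNReal.ofReal ρ ≤ genRadius a) : IsSubexponential fun k => ‖a k‖ * ρ ^ k * m := by
  refine ⟨fun k => by positivity, fun ε hε => ?_⟩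
  have hlt : ρ * Real.exp (-(ε / 2)) < ρ :=
    mul_lt_of_lt_one_right hρ (Real.exp_lt_one_iff.2 (by linarith))
  obtain ⟨C, hC0, hC⟩ := exists_bound_of_lt_genRadius (a := a) (r := ρ * Real.exp (-(ε / 2)))
    (by positivity) (((ENNReal.ofReal_lt_ofReal_iff hρ).2 hlt).trans_le h)
  have hlim : Tendsto (fun k : ℕ => C * m * Real.exp (-(ε / 2)) ^ k) atTop (𝓝 0) := by
    simpa using (tendsto_pow_atTop_nhds_zero_of_lt_one (Real.exp_pos _).le
      (Real.exp_lt_one_iff.2 (by linarith : -(ε / 2) < 0))).const_mul (C * m)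
  refine squeeze_zero (fun k => by positivity) (fun k => ?_) hlim
  have h1 : Real.exp (ε * k) = (Real.exp (-(ε / 2)) ^ k * Real.exp (-(ε / 2)) ^ k)⁻¹ := by
    rw [← Real.exp_nat_mul, ← Real.exp_add, ← Real.exp_neg]
    congr 1; ring
  calc ‖a k‖ * ρ ^ k * m / Real.exp (ε * k)
      = (‖a k‖ * (ρ * Real.exp (-(ε / 2))) ^ k) * m * Real.exp (-(ε / 2)) ^ k := by
        rw [h1, div_inv_eq_mul, mul_pow]; ring
    _ ≤ _ := by gcongr; exact hC k

/-- With `ρ ≥ r` the auxiliary radius, passing from `r` to `ρ` increases `|a_k| r^k` by a factor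
`(ρ / r)^k`, which is at least the factor `(ρ / r)^i` for the initial terms. -/
theorem PoincareRecurrence.IsSolution.taylorDomination {d : ℕ} {S : PoincareRecurrence d}
    {a : ℕ → ℂ} (ha : S.IsSolution a) (ha0 : a ≠ 0) {r : ℝ} (hr : 0 < r)
    (h : ENNReal.ofReal r ≤ genRadius a) :
    TaylorDomination a (d - 1) r (dominatingSeq a (d - 1) r) := by
  obtain ⟨hrρ, hρ⟩ := auxRadius_spec h
  set ρ := auxRadius a r with hρdef
  have hρ0 : 0 < ρ := hr.trans_le hrρ
  have hm := ha.initialMax_pos ha0 hρ0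
  refine ⟨hr, h, isSubexponential_of_le_genRadius hρ0 (inv_nonneg.2 hm.le) hρ, fun k hk => ?_⟩
  have key : initialMax a (d - 1) ρ * r ^ k ≤ ρ ^ k * initialMax a (d - 1) r := by
    rw [← le_div_iff₀ (by positivity)]
    refine sup'_le _ _ fun i hi => ?_
    rw [mem_range] at hi
    rw [le_div_iff₀ (by positivity)]
    -- `ρ ^ i * r ^ k ≤ ρ ^ k * r ^ i`, because `i ≤ k` and `r ≤ ρ`
    have hpow : r ^ (k - i) ≤ ρ ^ (k - i) := by gcongr
    have hik : i + (k - i) = k := by omega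
    calc ‖a i‖ * ρ ^ i * r ^ k = ‖a i‖ * ρ ^ i * (r ^ i * r ^ (k - i)) := by rw [← pow_add, hik]
      _ ≤ ‖a i‖ * ρ ^ i * (r ^ i * ρ ^ (k - i)) := by gcongr
      _ = ρ ^ (i + (k - i)) * (‖a i‖ * r ^ i) := by rw [pow_add]; ring
      _ ≤ ρ ^ k * initialMax a (d - 1) r := by
          rw [hik]
          gcongr
          exact le_initialMax a r (by omega)
  rw [dominatingSeq, ← hρdef]
  calc ‖a k‖ * r ^ k
      = ‖a k‖ * (initialMax a (d - 1) ρ)⁻¹ * (initialMax a (d - 1) ρ * r ^ k) := by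
        field_simp
    _ ≤ ‖a k‖ * (initialMax a (d - 1) ρ)⁻¹ * (ρ ^ k * initialMax a (d - 1) r) := by gcongr
    _ = _ := by ring

/-! ### The radius of convergence and the characteristic roots -/

theorem PoincareRecurrence.charPoly_eval_zero {d : ℕ} (S : PoincareRecurrence d) (hd : 1 ≤ d) :
    S.charPoly.eval 0 = -S.c d := by
  rw [charPoly, eval_sub, eval_finsetSum, sum_eq_single_of_mem d (mem_Icc.2 ⟨hd, le_rfl⟩)]
  · simp [show d ≠ 0 by omega]
  · intro j hj hjd
    rw [mem_Icc] at hj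
    simp [show d - j ≠ 0 by omega]

theorem PoincareRecurrence.IsSolution.exists_root_genRadius_eq {d : ℕ} {S : PoincareRecurrence d}
    {a : ℕ → ℂ} (hd : 1 ≤ d) (ha : S.IsSolution a) (hne : ¬ ∀ᶠ k in atTop, a k = 0) :
    ∃ σ : ℂ, S.charPoly.IsRoot σ ∧ genRadius a = ‖σ‖ₑ⁻¹ := by
  by_cases htop : genRadius a = ⊤
  · refine ⟨0, ?_, by simp [htop]⟩
    rw [IsRoot, S.charPoly_eval_zero hd, neg_eq_zero]
    by_contra hc
    exact hne (ha.eventually_eq_zero_of_genRadius_eq_top hd htop hc)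
  · have hR0 : 0 < (genRadius a).toReal := ENNReal.toReal_pos (ha.genRadius_pos hd).ne' htop
    obtain ⟨σ, hσ, h⟩ := ha.exists_mem_roots_norm_mul_eq_one hd hR0
      (ENNReal.ofReal_toReal htop).symm
    refine ⟨σ, isRoot_of_mem_roots hσ, ?_⟩
    have hσ0 : 0 < ‖σ‖ := pos_of_mul_pos_left (by rw [h]; exact one_pos) hR0.le
    rw [← ofReal_norm, ← ENNReal.ofReal_inv_of_pos hσ0, ← eq_inv_of_mul_eq_one_right h,
      ENNReal.ofReal_toReal htop]

end PoincarePerron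

theorem mainTheorem4 (d : ℕ) (hd : 1 ≤ d) (S : PoincarePerron.PoincareRecurrence d)
    (a : ℕ → ℂ) (ha : S.IsSolution a) (ha0 : a ≠ 0) :
    0 < PoincarePerron.genRadius a ∧
    ((∀ᶠ k in Filter.atTop, a k = 0) → PoincarePerron.genRadius a = ⊤) ∧
    ((¬ ∀ᶠ k in Filter.atTop, a k = 0) →
      ∃ σ : ℂ, S.charPoly.IsRoot σ ∧ PoincarePerron.genRadius a = ‖σ‖ₑ⁻¹) ∧
    (∀ r : ℝ, 0 < r → ENNReal.ofReal r ≤ PoincarePerron.genRadius a →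
      PoincarePerron.TaylorDomination a (d - 1) r
        (PoincarePerron.dominatingSeq a (d - 1) r)) := by
  exact ⟨ha.genRadius_pos hd, PoincarePerron.genRadius_eq_top_of_eventually_eq_zero,
    ha.exists_root_genRadius_eq hd, fun _ hr h => ha.taylorDomination ha0 hr h⟩
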